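/- Let $X$ be a compact metric space, $T:X\to X$ a minimal homeomorphism (every orbit $\{T^n(x):n\in\mathbb Z\}$ is dense), and $\rho:X\to\mathbb R$ a continuous function. Let $F:X\times\mathbb R\to X\times\mathbb R$, $F(x,v)=(T(x),\,v+\rho(x))$, be the associated cylindrical cascade, and for $n\ge 1$ let $\rho_n(x)=\sum_{j=0}^{n-1}\rho(T^j(x))$. The orbit of $(x,v)$ under $F$ is called proper if $n\mapsto F^n(x,v)$ is a proper map from $\mathbb Z$ (with the discrete topology) to $X\times\mathbb R$; since $F$ commutes with the translations of the second coordinate, this depends only on $x$. Then the following are equivalent: (1) there is a sequence of continuous functions $\varphi_k:X\to\mathbb R$ such that $$\lim_{k\to\infty}\ \sup_{x\in X}\bigl|\rho(x)-[\varphi_k(T(x))-\varphi_k(x)]\bigr|=0;$$ (2) $\displaystyle\lim_{n\to\infty}\ \sup_{x\in X}\Bigl|\frac{\rho_n(x)}{n}\Bigr|=0;$ (3) for every $T$-invariant Borel probability measure $\mu$ on $X$, the union of the proper orbits of $F$ has zero $\mu$-measure, that is, its projection to $X$ (the set of $x\in X$ such that the $F$-orbits of the points over $x$ are proper) is $\mu$-null;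 (4) $\displaystyle\int_X\rho\,d\mu=0$ for every $T$-invariant Borel probability measure $\mu$ on $X$; (4') $\displaystyle\int_X\rho\,d\mu=0$ for every $T$-invariant ergodic Borel probability measure $\mu$ on $X$. -/

import Mathlib

open Filter Topology MeasureTheory

/-- The homeomorphism `T` is minimal: every (two-sided) orbit is dense. -/
def IsMinimalHomeo {X : Type*} [TopologicalSpace X] (T : X ≃ₜ X) : Prop :=
  ∀ x : X, Dense (Set.range fun n : ℤ => (T ^ n) x)

/-- The cylindrical cascade `(x, v) ↦ (T x, v + ρ x)` on `X × ℝ`, as a homeomorphism. -/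
def cylindricalCascade {X : Type*} [TopologicalSpace X] (T : X ≃ₜ X) (ρ : C(X, ℝ)) :
    (X × ℝ) ≃ₜ (X × ℝ) where
  toFun p := (T p.1, p.2 + ρ p.1)
  invFun p := (T.symm p.1, p.2 - ρ (T.symm p.1))
  left_inv p := by simp
  right_inv p := by simp
  continuous_toFun := by fun_prop
  continuous_invFun := by fun_prop

/-- The two-sided orbit of `p` under the homeomorphism `F`, parametrized by `ℤ`. -/
def orbitMap {Y : Type*} [TopologicalSpace Y] (F : Y ≃ₜ Y) (p : Y) : ℤ → Y :=
  fun n => (F ^ n) p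

/-- The union of the proper orbits of `F`: the orbit of `p` is proper when it is proper as a map
from (the discrete space) `ℤ` to the phase space. -/
def properOrbitUnion {Y : Type*} [TopologicalSpace Y] (F : Y ≃ₜ Y) : Set Y :=
  ⋃ p ∈ {p : Y | IsProperMap (orbitMap F p)}, Set.range (orbitMap F p)

/-! A coboundary has bounded Birkhoff sums, so uniform limits of coboundaries have uniformly small
averages. Conversely, with `S_j` the Birkhoff sums of `ρ`, the function `φ_n = -(1/n) ∑_{j<n} S_j`
satisfies `ρ - (φ_n ∘ T - φ_n) = S_n / n`.

If the averages are not uniformly small, empirical measures on bad orbit segments accumulate at an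
invariant measure with nonzero integral of `ρ` (`exists_invariant_limit`). Ergodic measures suffice
because, by Krein–Milman, the maximum of `∫ ρ` over invariant measures is attained at an ergodic
one; the same holds for `-ρ`.

Since `X` is compact, an orbit of the cascade is proper exactly when its vertical coordinate escapes
to infinity in both time directions. If `∫ ρ > 0`, the maximal ergodic theorem shows that this
happens on a nonnull set. If the sums are uniformly sublinear, a pigeonhole count (`card_visits_le`)
shows that even forward escape is almost surely impossible. -/

/-- The suprema of absolute values tend to zero exactly when the functions tend to zero
uniformly. -/
theorem tendsto_iSup_abs_zero_iff {X : Type*} [TopologicalSpace X] [CompactSpace X]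
    (f : ℕ → X → ℝ) (hf : ∀ k, Continuous (f k)) :
    Tendsto (fun k => ⨆ x, |f k x|) atTop (𝓝 0) ↔
      ∀ ε > 0, ∀ᶠ k in atTop, ∀ x, |f k x| ≤ ε := by
  have hb : ∀ k, BddAbove (Set.range fun x => |f k x|) := fun k =>
    (isCompact_range (hf k).abs).bddAbove
  rw [Metric.tendsto_nhds]
  constructor
  · intro h ε hε
    filter_upwards [h ε hε] with k hk x
    rw [Real.dist_0_eq_abs] at hk
    exact (le_ciSup (hb k) x).trans ((le_abs_self _).trans hk.le)
  · intro h ε hε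
    filter_upwards [h (ε / 2) (half_pos hε)] with k hk
    rw [Real.dist_0_eq_abs, abs_of_nonneg (Real.iSup_nonneg fun x => abs_nonneg _)]
    exact (Real.iSup_le hk (half_pos hε).le).trans_lt (half_lt_self hε)

/-! ### Birkhoff averages and approximation by coboundaries -/

theorem continuous_birkhoffSum {X : Type*} [TopologicalSpace X] {T : X → X} {f : X → ℝ}
    (hT : Continuous T) (hf : Continuous f) (n : ℕ) : Continuous (birkhoffSum T f n) := by
  unfold birkhoffSum
  exact continuous_finsetSum _ fun k _ => hf.comp (hT.iterate k)

theorem tendsto_iSup_abs_birkhoffSum_div_iff {X : Type*} [TopologicalSpace X] [CompactSpace X]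
    {T : X → X} {f : X → ℝ} (hT : Continuous T) (hf : Continuous f) :
    Tendsto (fun n : ℕ => ⨆ x : X, |birkhoffSum T f n x / (n : ℝ)|) atTop (𝓝 0) ↔
      ∀ ε > 0, ∀ᶠ n : ℕ in atTop, ∀ x, |birkhoffSum T f n x| ≤ ε * n := by
  rw [tendsto_iSup_abs_zero_iff (fun (n : ℕ) x => birkhoffSum T f n x / (n : ℝ))
    fun n => (continuous_birkhoffSum hT hf n).div_const _]
  refine forall₂_congr fun ε _ => ?_
  refine eventually_congr ?_
  filter_upwards [eventually_gt_atTop 0] with n hn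
  have : (0 : ℝ) < n := by exact_mod_cast hn
  refine forall_congr' fun x => ?_
  rw [abs_div, abs_of_pos this, div_le_iff₀ this]

theorem abs_birkhoffSum_le {X : Type*} {T : X → X} {f : X → ℝ} {C : ℝ} (h : ∀ x, |f x| ≤ C)
    (n : ℕ) (x : X) : |birkhoffSum T f n x| ≤ n * C := by
  unfold birkhoffSum
  refine (Finset.abs_sum_le_sum_abs _ _).trans ?_
  refine (Finset.sum_le_sum fun k _ => h _).trans ?_
  simp

theorem birkhoffSum_coboundary {X : Type*} (T : X → X) (f : X → ℝ) (n : ℕ) (x : X) :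
    birkhoffSum T (fun y => f (T y) - f y) n x = f (T^[n] x) - f x := by
  induction n with
  | zero => simp
  | succ n ih => rw [birkhoffSum_succ, ih, Function.iterate_succ_apply']; ring

/-- Uniform limits of coboundaries have Birkhoff averages tending uniformly to zero. -/
theorem birkhoffSum_small_of_approx_coboundary {X : Type*} [TopologicalSpace X] [CompactSpace X]
    {T : X → X} {f : X → ℝ}
    (h : ∀ ε > 0, ∃ φ : C(X, ℝ), ∀ x, |f x - (φ (T x) - φ x)| ≤ ε) :
    ∀ ε > 0, ∀ᶠ n : ℕ in atTop, ∀ x, |birkhoffSum T f n x| ≤ ε * n := by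
  intro ε hε
  obtain ⟨φ, hφ⟩ := h (ε / 2) (half_pos hε)
  -- Beyond `N`, the telescoped term, at most `2‖φ‖`, uses only half of the allowance `ε * n`; the
  -- approximation error takes the other half.
  obtain ⟨N, hN⟩ := exists_nat_ge (2 * ‖φ‖ / (ε / 2))
  filter_upwards [eventually_ge_atTop N] with n hn x
  have h1 : birkhoffSum T f n x =
      birkhoffSum T (fun y => f y - (φ (T y) - φ y)) n x + (φ (T^[n] x) - φ x) := by
    rw [← birkhoffSum_coboundary T φ n x, ← birkhoffSum_add']
    congr 1
    ext y
    simp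
  have h2 := abs_birkhoffSum_le (T := T) hφ n x
  have h3 := φ.norm_coe_le_norm (T^[n] x)
  have h4 := φ.norm_coe_le_norm x
  rw [Real.norm_eq_abs] at h3 h4
  have h5 : 2 * ‖φ‖ ≤ n * (ε / 2) := by
    rw [← div_le_iff₀ (half_pos hε)]
    exact hN.trans (by exact_mod_cast hn)
  rw [h1]
  have h6 := abs_add_le (birkhoffSum T (fun y => f y - (φ (T y) - φ y)) n x) (φ (T^[n] x) - φ x)
  have h7 := abs_sub (φ (T^[n] x)) (φ x)
  linarith

/-- The average of the first `n` Birkhoff sums is a transfer function between `-f` and the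
negative of the Birkhoff average. -/
theorem sub_transfer_birkhoffSum {X : Type*} (T : X → X) (f : X → ℝ) {n : ℕ} (hn : n ≠ 0) (x : X) :
    f x - ((-(∑ j ∈ Finset.range n, birkhoffSum T f j (T x)) / n)
      - (-(∑ j ∈ Finset.range n, birkhoffSum T f j x) / n)) = birkhoffSum T f n x / n := by
  have h : ∑ j ∈ Finset.range n, birkhoffSum T f j (T x) - ∑ j ∈ Finset.range n, birkhoffSum T f j x
      = birkhoffSum T f n x - n * f x := by
    rw [← Finset.sum_sub_distrib]
    -- Each difference telescopes to `f (T^[j] x) - f x`.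
    simp_rw [birkhoffSum_apply_sub_birkhoffSum, Finset.sum_sub_distrib]
    simp [birkhoffSum]
  have hn' : (n : ℝ) ≠ 0 := by exact_mod_cast hn
  field_simp
  linarith

theorem exists_approx_coboundary {X : Type*} [TopologicalSpace X] [CompactSpace X]
    {T : X → X} {f : X → ℝ} (hT : Continuous T) (hf : Continuous f)
    (h : Tendsto (fun n : ℕ => ⨆ x : X, |birkhoffSum T f n x / (n : ℝ)|) atTop (𝓝 0)) :
    ∃ φ : ℕ → C(X, ℝ), Tendsto (fun k => ⨆ x : X, |f x - (φ k (T x) - φ k x)|) atTop (𝓝 0) := by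
  refine ⟨fun n => ⟨fun x => -(∑ j ∈ Finset.range n, birkhoffSum T f j x) / n, ?_⟩, ?_⟩
  · exact ((continuous_finsetSum _ fun j _ => continuous_birkhoffSum hT hf j).neg).div_const _
  · refine h.congr' ?_
    filter_upwards [eventually_ne_atTop 0] with n hn
    simp_rw [ContinuousMap.coe_mk, sub_transfer_birkhoffSum T f hn]

/-! ### Invariant measures as limits of empirical measures -/

theorem integral_birkhoffSum {X : Type*} [MeasurableSpace X] {μ : Measure X} {T : X → X}
    (hT : MeasurePreserving T μ μ) {f : X → ℝ} (hf : Integrable f μ) (n : ℕ) :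
    ∫ x, birkhoffSum T f n x ∂μ = n * ∫ x, f x ∂μ := by
  unfold birkhoffSum
  have hi : ∀ k, Integrable (fun x => f (T^[k] x)) μ := fun k =>
    (hT.iterate k).integrable_comp_of_integrable hf
  rw [integral_finsetSum _ fun k _ => hi k]
  have : ∀ k, ∫ x, f (T^[k] x) ∂μ = ∫ x, f x ∂μ := fun k => by
    have h := (hT.iterate k).map_eq
    conv_rhs => rw [← h]
    rw [integral_map (hT.iterate k).measurable.aemeasurable]
    rw [h]; exact hf.1
  simp [this]

/-- The witness is the uniform measure on the orbit segment. The condition `n ≠ 0` sits inside the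
existential so that a measure can be chosen for every `n`; for `n = 0` it is arbitrary. -/
theorem exists_empirical_probabilityMeasure {X : Type*} [TopologicalSpace X]
    [MeasurableSpace X] [BorelSpace X] [T1Space X] (T : X → X) (n : ℕ) (x : X) :
    ∃ ν : ProbabilityMeasure X, n ≠ 0 → ∀ f : X → ℝ,
      ∫ y, f y ∂(ν : Measure X) = birkhoffSum T f n x / n := by
  by_cases hn : n = 0
  · exact ⟨⟨Measure.dirac x, inferInstance⟩, fun h => absurd hn h⟩
  let ν : Measure X := (n : ENNReal)⁻¹ • ∑ k ∈ Finset.range n, Measure.dirac (T^[k] x)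
  have hν : IsProbabilityMeasure ν := by
    constructor
    simp [ν, ENNReal.inv_mul_cancel, hn]
  refine ⟨⟨ν, hν⟩, fun _ f => ?_⟩
  simp only [ProbabilityMeasure.coe_mk, ν, integral_smul_measure]
  rw [integral_finsetSum_measure fun k _ => integrable_dirac (by simp)]
  simp [birkhoffSum, div_eq_inv_mul]

theorem integrable_continuousMap {X : Type*} [TopologicalSpace X] [CompactSpace X]
    [MeasurableSpace X] [OpensMeasurableSpace X] (μ : Measure X) [IsFiniteMeasure μ]
    (f : C(X, ℝ)) : Integrable f μ :=
  (BoundedContinuousFunction.mkOfCompact f).integrable μ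

theorem measure_ext_of_integral_continuousMap {X : Type*} [MetricSpace X] [CompactSpace X]
    [MeasurableSpace X] [BorelSpace X] {μ ν : Measure X} [IsFiniteMeasure μ] [IsFiniteMeasure ν]
    (h : ∀ f : C(X, ℝ), ∫ x, f x ∂μ = ∫ x, f x ∂ν) : μ = ν :=
  ext_of_forall_integral_eq_of_IsFiniteMeasure fun f => h f.toContinuousMap

/-- Limits of empirical measures along orbit segments of growing length are invariant. -/
theorem exists_invariant_limit {X : Type*} [MetricSpace X] [CompactSpace X]
    [MeasurableSpace X] [BorelSpace X] {T : X → X} (hT : Continuous T) (x : ℕ → X)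
    (l : Ultrafilter ℕ) (hl : (l : Filter ℕ) ≤ atTop) :
    ∃ μ : Measure X, IsProbabilityMeasure μ ∧ MeasurePreserving T μ μ ∧
      ∀ f : C(X, ℝ), Tendsto (fun n : ℕ => birkhoffSum T f n (x n) / n) l (𝓝 (∫ y, f y ∂μ)) := by
  choose ν hν using fun n => exists_empirical_probabilityMeasure T n (x n)
  obtain ⟨μ, -, hμ⟩ := isCompact_univ.ultrafilter_le_nhds (l.map ν) (by simp)
  have hlim : ∀ f : C(X, ℝ),
      Tendsto (fun n : ℕ => birkhoffSum T f n (x n) / n) l (𝓝 (∫ y, f y ∂(μ : Measure X))) := by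
    intro f
    have h1 := (ProbabilityMeasure.tendsto_iff_forall_integral_tendsto (F := (l : Filter ℕ))
      (μs := ν)).1 hμ (BoundedContinuousFunction.mkOfCompact f)
    refine h1.congr' ?_
    filter_upwards [hl (eventually_ne_atTop 0)] with n hn
    exact hν n hn f
  refine ⟨μ, inferInstance, ⟨hT.measurable, ?_⟩, hlim⟩
  have : IsProbabilityMeasure (Measure.map T (μ : Measure X)) :=
    Measure.isProbabilityMeasure_map hT.measurable.aemeasurable
  refine measure_ext_of_integral_continuousMap fun f => ?_
  rw [integral_map hT.measurable.aemeasurable f.continuous.aestronglyMeasurable]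
  have h1 := (hlim (f.comp ⟨T, hT⟩)).sub (hlim f)
  -- Invariance of the limit: the averages of `f ∘ T` and `f` differ only by boundary terms, of size
  -- at most `2‖f‖ / n`.
  have h2 : Tendsto (fun n : ℕ => birkhoffSum T (f.comp ⟨T, hT⟩) n (x n) / n
      - birkhoffSum T f n (x n) / n) l (𝓝 0) := by
    have h3 : Tendsto (fun n : ℕ => 2 * ‖f‖ / (n : ℝ)) l (𝓝 0) :=
      (tendsto_const_div_atTop_nhds_zero_nat _).mono_left hl
    refine squeeze_zero_norm (fun n => ?_) h3
    have h4 : birkhoffSum T (f.comp ⟨T, hT⟩) n (x n) - birkhoffSum T f n (x n)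
        = f (T^[n] (x n)) - f (x n) := by
      rw [← birkhoffSum_coboundary T f n (x n)]
      simp [birkhoffSum, Finset.sum_sub_distrib]
    rw [← sub_div, h4, norm_div, Real.norm_natCast]
    gcongr
    have h5 := f.norm_coe_le_norm (T^[n] (x n))
    have h6 := f.norm_coe_le_norm (x n)
    have h7 := norm_sub_le (f (T^[n] (x n))) (f (x n))
    linarith
  exact sub_eq_zero.1 (tendsto_nhds_unique h1 h2)

theorem birkhoffSum_small_of_integral_eq_zero {X : Type*} [MetricSpace X] [CompactSpace X]
    [MeasurableSpace X] [BorelSpace X] {T : X → X} (hT : Continuous T) (f : C(X, ℝ))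
    (h : ∀ μ : Measure X, IsProbabilityMeasure μ → MeasurePreserving T μ μ → ∫ x, f x ∂μ = 0) :
    ∀ ε > 0, ∀ᶠ n : ℕ in atTop, ∀ x, |birkhoffSum T f n x| ≤ ε * n := by
  intro ε hε
  by_contra hcon
  have hfreq : ∃ᶠ n : ℕ in atTop, ∃ x, ε * n < |birkhoffSum T f n x| := by
    rw [not_eventually] at hcon
    refine hcon.mono fun n hn => ?_
    push Not at hn
    exact hn
  obtain ⟨_, x₀, _⟩ := hfreq.exists
  have hch : ∀ n : ℕ, ∃ x, (∃ x, ε * n < |birkhoffSum T f n x|) →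
      ε * n < |birkhoffSum T f n x| := by
    intro n
    by_cases hn : ∃ x, ε * n < |birkhoffSum T f n x|
    · obtain ⟨x, hx⟩ := hn
      exact ⟨x, fun _ => hx⟩
    · exact ⟨x₀, fun h => absurd h hn⟩
  choose x hx using hch
  have hne := frequently_iff_neBot.1 hfreq
  -- An ultrafilter concentrated on the bad times replaces the choice of a convergent subsequence.
  let l := Ultrafilter.of (atTop ⊓ 𝓟 {n : ℕ | ∃ x, ε * n < |birkhoffSum T f n x|})
  have hl : (l : Filter ℕ) ≤ atTop ⊓ 𝓟 {n : ℕ | ∃ x, ε * n < |birkhoffSum T f n x|} :=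
    Ultrafilter.of_le _
  obtain ⟨μ, hμ, hμT, hlim⟩ := exists_invariant_limit hT x l (hl.trans inf_le_left)
  have h1 := (hlim f).abs
  rw [h μ hμ hμT, abs_zero] at h1
  have h2 : ∀ᶠ n : ℕ in l, ε ≤ |birkhoffSum T f n (x n) / n| := by
    filter_upwards [hl (mem_inf_of_left (eventually_gt_atTop 0)),
      hl (mem_inf_of_right (mem_principal_self _))] with n hn hn'
    have : (0 : ℝ) < n := by exact_mod_cast hn
    rw [abs_div, abs_of_pos this, le_div_iff₀ this]
    exact (hx n hn').le
  exact absurd (ge_of_tendsto h1 h2) (not_le.2 hε)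

/-! ### Reduction to ergodic measures -/

/-- Among the invariant probability measures maximizing the integral of a continuous function,
there is an ergodic one. -/
theorem exists_ergodic_integral_ge {X : Type*} [MetricSpace X] [CompactSpace X]
    [MeasurableSpace X] [BorelSpace X] {T : X → X} (hT : Continuous T) (f : C(X, ℝ))
    {μ₀ : Measure X} [IsProbabilityMeasure μ₀] (hμ₀ : MeasurePreserving T μ₀ μ₀) :
    ∃ μ : Measure X, IsProbabilityMeasure μ ∧ Ergodic T μ ∧ ∫ x, f x ∂μ₀ ≤ ∫ x, f x ∂μ := by
  -- `Φ` carries measures into a locally convex vector space, where Krein–Milman applies.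
  let Φ : ProbabilityMeasure X → (C(X, ℝ) → ℝ) := fun μ g => ∫ x, g x ∂(μ : Measure X)
  have hΦ : Continuous Φ := continuous_pi fun g =>
    ProbabilityMeasure.continuous_integral_boundedContinuousFunction
      (BoundedContinuousFunction.mkOfCompact g)
  let K : Set (ProbabilityMeasure X) := {μ | μ.map hT.measurable.aemeasurable = μ}
  have hK : IsCompact K :=
    (isClosed_eq (ProbabilityMeasure.continuous_map hT) continuous_id).isCompact
  have hKmem : ∀ μ : ProbabilityMeasure X, μ ∈ K ↔ MeasurePreserving T (μ : Measure X) μ := by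
    intro μ
    constructor
    · exact fun h => ⟨hT.measurable, congrArg ProbabilityMeasure.toMeasure h⟩
    · exact fun h => Subtype.ext h.map_eq
  have hK₀ : (⟨μ₀, inferInstance⟩ : ProbabilityMeasure X) ∈ K := (hKmem _).2 hμ₀
  have hΦf : Continuous fun μ => Φ μ f := (continuous_apply f).comp hΦ
  obtain ⟨m, hmK, hm⟩ := hK.exists_isMaxOn ⟨_, hK₀⟩ hΦf.continuousOn
  let M : Set (ProbabilityMeasure X) := {μ ∈ K | Φ μ f = Φ m f}
  have hM : IsCompact M := hK.inter_right (isClosed_eq hΦf continuous_const)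
  obtain ⟨_, ⟨μ, hμM, rfl⟩, hext⟩ :=
    (hM.image hΦ).extremePoints_nonempty (Set.Nonempty.image Φ ⟨m, hmK, rfl⟩)
  refine ⟨μ, inferInstance, Ergodic.of_mem_extremePoints ?_, ?_⟩
  · rw [mem_extremePoints_iff_left]
    refine ⟨⟨(hKmem μ).1 hμM.1, inferInstance⟩, ?_⟩
    rintro ν₁ ⟨hν₁T, hν₁⟩ ν₂ ⟨hν₂T, hν₂⟩ ⟨a, b, ha, hb, hab, hμ⟩
    have ha1 : a ≠ ⊤ := ne_top_of_le_ne_top ENNReal.one_ne_top (hab ▸ le_self_add)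
    have hb1 : b ≠ ⊤ := ne_top_of_le_ne_top ENNReal.one_ne_top (hab ▸ le_add_self)
    have ha0 : 0 < a.toReal := ENNReal.toReal_pos ha.ne' ha1
    have hb0 : 0 < b.toReal := ENNReal.toReal_pos hb.ne' hb1
    have hab' : a.toReal + b.toReal = 1 := by
      rw [← ENNReal.toReal_add ha1 hb1, hab, ENNReal.toReal_one]
    have hint : ∀ g : C(X, ℝ), Φ μ g = a.toReal * ∫ x, g x ∂ν₁ + b.toReal * ∫ x, g x ∂ν₂ := by
      intro g
      simp only [Φ]
      rw [← hμ, integral_add_measure ((integrable_continuousMap ν₁ g).smul_measure ha1)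
        ((integrable_continuousMap ν₂ g).smul_measure hb1)]
      simp
    -- The maximizers form a face: a convex combination reaches the maximum only if both components
    -- do. Hence an extreme point of their image is extreme among all invariant measures.
    have h1 : ∫ x, f x ∂ν₁ ≤ Φ m f := hm ((hKmem ⟨ν₁, hν₁⟩).2 hν₁T)
    have h2 : ∫ x, f x ∂ν₂ ≤ Φ m f := hm ((hKmem ⟨ν₂, hν₂⟩).2 hν₂T)
    have h3 : a.toReal * ∫ x, f x ∂ν₁ + b.toReal * ∫ x, f x ∂ν₂ = Φ m f :=
      (hint f).symm.trans hμM.2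
    have h4 : Φ m f = a.toReal * Φ m f + b.toReal * Φ m f := by
      rw [← add_mul, hab', one_mul]
    have h5 : ∫ x, f x ∂ν₁ = Φ m f := by
      refine le_antisymm h1 (le_of_mul_le_mul_left ?_ ha0)
      linarith [mul_le_mul_of_nonneg_left h2 hb0.le]
    have h6 : ∫ x, f x ∂ν₂ = Φ m f := by
      refine le_antisymm h2 (le_of_mul_le_mul_left ?_ hb0)
      linarith [mul_le_mul_of_nonneg_left h1 ha0.le]
    have h7 : Φ ⟨ν₁, hν₁⟩ = Φ μ := by
      refine hext ⟨⟨ν₁, hν₁⟩, ⟨(hKmem _).2 hν₁T, h5⟩, rfl⟩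
        ⟨⟨ν₂, hν₂⟩, ⟨(hKmem _).2 hν₂T, h6⟩, rfl⟩ ⟨a.toReal, b.toReal, ha0, hb0, hab', ?_⟩
      ext g
      simp [hint g, Φ]
    exact measure_ext_of_integral_continuousMap fun g => congrFun h7 g
  · exact (hm hK₀).trans hμM.2.ge

theorem integral_eq_zero_of_ergodic {X : Type*} [MetricSpace X] [CompactSpace X]
    [MeasurableSpace X] [BorelSpace X] {T : X → X} (hT : Continuous T) (f : C(X, ℝ))
    (h : ∀ μ : Measure X, IsProbabilityMeasure μ → Ergodic T μ → ∫ x, f x ∂μ = 0)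
    {μ : Measure X} [IsProbabilityMeasure μ] (hμ : MeasurePreserving T μ μ) :
    ∫ x, f x ∂μ = 0 := by
  obtain ⟨ν, hν, hνe, h1⟩ := exists_ergodic_integral_ge hT f hμ
  obtain ⟨ν', hν', hνe', h2⟩ := exists_ergodic_integral_ge hT (-f) hμ
  have h3 := h ν hν hνe
  have h4 := h ν' hν' hνe'
  simp only [ContinuousMap.coe_neg, Pi.neg_apply, integral_neg] at h2
  linarith

/-! ### The maximal ergodic theorem -/

/-- The maximum of the Birkhoff sums of order at most `n`. -/
noncomputable def maxBirkhoffSum {X : Type*} (T : X → X) (f : X → ℝ) : ℕ → X → ℝ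
  | 0 => fun _ => 0
  | n + 1 => fun x => max 0 (f x + maxBirkhoffSum T f n (T x))

theorem maxBirkhoffSum_nonneg {X : Type*} (T : X → X) (f : X → ℝ) (n : ℕ) (x : X) :
    0 ≤ maxBirkhoffSum T f n x := by
  cases n with
  | zero => exact le_rfl
  | succ n => exact le_max_left _ _

theorem maxBirkhoffSum_le_succ {X : Type*} (T : X → X) (f : X → ℝ) (n : ℕ) (x : X) :
    maxBirkhoffSum T f n x ≤ maxBirkhoffSum T f (n + 1) x := by
  induction n generalizing x with
  | zero => exact maxBirkhoffSum_nonneg T f 1 x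
  | succ n ih => exact max_le_max le_rfl (add_le_add le_rfl (ih (T x)))

theorem birkhoffSum_le_maxBirkhoffSum {X : Type*} (T : X → X) (f : X → ℝ) (n : ℕ) (x : X) :
    birkhoffSum T f n x ≤ maxBirkhoffSum T f n x := by
  induction n generalizing x with
  | zero => simp [maxBirkhoffSum]
  | succ n ih =>
    rw [birkhoffSum_succ']
    exact (add_le_add le_rfl (ih (T x))).trans (le_max_right _ _)

/-- Garsia's inequality: a positive maximum is not attained by the empty sum, so its first term `f
x` can be split off. -/
theorem maxBirkhoffSum_le_of_pos {X : Type*} (T : X → X) (f : X → ℝ) (n : ℕ) (x : X)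
    (hx : 0 < maxBirkhoffSum T f n x) :
    maxBirkhoffSum T f n x ≤ f x + maxBirkhoffSum T f n (T x) := by
  cases n with
  | zero => exact absurd hx (lt_irrefl _)
  | succ n =>
    have h : maxBirkhoffSum T f (n + 1) x = f x + maxBirkhoffSum T f n (T x) := by
      rcases max_choice 0 (f x + maxBirkhoffSum T f n (T x)) with h | h
      · exact absurd (h.symm.trans_gt hx) (lt_irrefl _)
      · exact h
    rw [h]
    exact add_le_add le_rfl (maxBirkhoffSum_le_succ T f n (T x))

theorem measurable_maxBirkhoffSum {X : Type*} [MeasurableSpace X] {T : X → X} (hT : Measurable T)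
    {f : X → ℝ} (hf : Measurable f) (n : ℕ) : Measurable (maxBirkhoffSum T f n) := by
  induction n with
  | zero => exact measurable_const
  | succ n ih => exact measurable_const.max (hf.add (ih.comp hT))

theorem integrable_maxBirkhoffSum {X : Type*} [MeasurableSpace X] {μ : Measure X}
    [IsFiniteMeasure μ] {T : X → X} (hT : MeasurePreserving T μ μ) {f : X → ℝ}
    (hf : Integrable f μ) (n : ℕ) : Integrable (maxBirkhoffSum T f n) μ := by
  induction n with
  | zero => exact integrable_const _
  | succ n ih =>
    exact (integrable_const 0).sup (hf.add (hT.integrable_comp_of_integrable ih))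

/-- **Maximal ergodic theorem**: if almost every point has a positive Birkhoff sum, then the
integral is nonnegative. -/
theorem integral_nonneg_of_exists_birkhoffSum_pos {X : Type*} [MeasurableSpace X] {μ : Measure X}
    [IsFiniteMeasure μ] {T : X → X} (hT : MeasurePreserving T μ μ) {f : X → ℝ}
    (hfm : Measurable f) (hf : Integrable f μ) (h : ∀ᵐ x ∂μ, ∃ n, 0 < birkhoffSum T f n x) :
    0 ≤ ∫ x, f x ∂μ := by
  let E : ℕ → Set X := fun n => {x | 0 < maxBirkhoffSum T f n x}
  have hE : ∀ n, MeasurableSet (E n) := fun n =>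
    measurableSet_lt measurable_const (measurable_maxBirkhoffSum hT.measurable hfm n)
  have hmono : Monotone E :=
    monotone_nat_of_le_succ fun n x hx => lt_of_lt_of_le hx (maxBirkhoffSum_le_succ T f n x)
  have hE0 : ∀ n, 0 ≤ ∫ x in E n, f x ∂μ := by
    intro n
    have hi := integrable_maxBirkhoffSum hT hf n
    have hi' : Integrable (fun x => maxBirkhoffSum T f n (T x)) μ :=
      hT.integrable_comp_of_integrable hi
    -- This integral vanishes by invariance, and its integrand is bounded above by `f` on `E n` and
    -- by `0` elsewhere.
    have h0 : ∫ x, (maxBirkhoffSum T f n x - maxBirkhoffSum T f n (T x)) ∂μ = 0 := by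
      rw [integral_sub hi hi', sub_eq_zero]
      conv_lhs => rw [← hT.map_eq]
      rw [integral_map hT.measurable.aemeasurable
        (measurable_maxBirkhoffSum hT.measurable hfm n).aestronglyMeasurable]
    rw [← integral_indicator (hE n), ← h0]
    refine integral_mono (hi.sub hi') (hf.indicator (hE n)) fun x => ?_
    by_cases hx : x ∈ E n
    · simp only [Set.indicator_of_mem hx]
      linarith [maxBirkhoffSum_le_of_pos T f n x hx]
    · simp only [Set.indicator_of_notMem hx]
      linarith [not_lt.1 (show ¬ 0 < maxBirkhoffSum T f n x from hx), maxBirkhoffSum_nonneg T f n (T x)]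
  have hlim := tendsto_setIntegral_of_monotone hE hmono hf.integrableOn
  have huniv : (⋃ n, E n) =ᵐ[μ] Set.univ := by
    rw [eventuallyEq_univ]
    filter_upwards [h] with x hx
    obtain ⟨n, hn⟩ := hx
    exact Set.mem_iUnion.2 ⟨n, hn.trans_le (birkhoffSum_le_maxBirkhoffSum T f n x)⟩
  rw [setIntegral_congr_set huniv, setIntegral_univ] at hlim
  exact ge_of_tendsto' hlim hE0

/-! ### Positive mean forces escape to infinity -/

theorem measurable_birkhoffSum {X : Type*} [MeasurableSpace X] {T : X → X} (hT : Measurable T)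
    {f : X → ℝ} (hf : Measurable f) (n : ℕ) : Measurable (birkhoffSum T f n) := by
  unfold birkhoffSum
  exact Finset.measurable_fun_sum _ fun k _ => hf.comp (hT.iterate k)

theorem measurableSet_birkhoffSum_tendsto_atTop {X : Type*} [MeasurableSpace X] {T : X → X}
    (hT : Measurable T) {f : X → ℝ} (hf : Measurable f) :
    MeasurableSet {x | Tendsto (fun n => birkhoffSum T f n x) atTop atTop} :=
  measurableSet_tendsto _ fun n => measurable_birkhoffSum hT hf n

theorem preimage_birkhoffSum_tendsto_atTop {X : Type*} (T : X → X) (f : X → ℝ) :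
    T ⁻¹' {x | Tendsto (fun n => birkhoffSum T f n x) atTop atTop} =
      {x | Tendsto (fun n => birkhoffSum T f n x) atTop atTop} := by
  ext x
  simp only [Set.mem_preimage, Set.mem_ofPred_eq]
  rw [← tendsto_add_atTop_iff_nat (f := fun n => birkhoffSum T f n x) 1]
  simp_rw [birkhoffSum_succ']
  constructor
  · exact fun h => tendsto_atTop_add_const_left _ _ h
  · intro h
    simpa using tendsto_atTop_add_const_left _ (-f x) h

/-- If `f` has positive integral, then so does its restriction to the set of points where the
Birkhoff sums tend to infinity. -/
theorem setIntegral_birkhoffSum_tendsto_atTop_pos {X : Type*} [MeasurableSpace X] {μ : Measure X}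
    [IsFiniteMeasure μ] {T : X → X} (hT : MeasurePreserving T μ μ) {f : X → ℝ}
    (hfm : Measurable f) (hf : Integrable f μ) (hpos : 0 < ∫ x, f x ∂μ) :
    0 < ∫ x in {x | Tendsto (fun n => birkhoffSum T f n x) atTop atTop}, f x ∂μ := by
  set B := {x | Tendsto (fun n => birkhoffSum T f n x) atTop atTop} with hBdef
  have hB : MeasurableSet B := measurableSet_birkhoffSum_tendsto_atTop hT.measurable hfm
  have hBT : T ⁻¹' B = B := preimage_birkhoffSum_tendsto_atTop T f
  obtain ⟨δ, hδ, hδμ⟩ : ∃ δ > 0, δ * μ.real Set.univ < ∫ x, f x ∂μ := by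
    refine ⟨(∫ x, f x ∂μ) / (μ.real Set.univ + 1), div_pos hpos (by positivity), ?_⟩
    rw [div_mul_eq_mul_div, div_lt_iff₀ (by positivity)]
    nlinarith
  have hTc : MeasurePreserving T (μ.restrict Bᶜ) (μ.restrict Bᶜ) := by
    have := hT.restrict_preimage hB.compl
    rwa [Set.preimage_compl, hBT] at this
  have hi : Integrable (fun x => δ - f x) μ := (integrable_const δ).sub hf
  -- Off `B` the sums of `f` lie below some constant infinitely often, so some sum of `δ - f` is
  -- positive. The maximal theorem then bounds `∫ f` over `Bᶜ` by `δ * μ(Bᶜ)`, which is less than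
  -- the full integral.
  have h1 : 0 ≤ ∫ x in Bᶜ, (δ - f x) ∂μ := by
    refine integral_nonneg_of_exists_birkhoffSum_pos hTc (measurable_const.sub hfm) hi.restrict ?_
    filter_upwards [ae_restrict_mem hB.compl] with x hx
    have hx' : ¬ Tendsto (fun n => birkhoffSum T f n x) atTop atTop := hx
    rw [tendsto_atTop] at hx'
    push Not at hx'
    obtain ⟨C, hC⟩ := hx'
    obtain ⟨N, hN⟩ := exists_nat_gt (C / δ)
    obtain ⟨n, hn, hnN⟩ := (hC.and_eventually (eventually_ge_atTop N)).exists
    refine ⟨n, ?_⟩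
    have h2 : birkhoffSum T (fun x => δ - f x) n x = n * δ - birkhoffSum T f n x := by
      simp [birkhoffSum]
    have h3 : C < n * δ := by
      rw [← div_lt_iff₀ hδ]
      exact hN.trans_le (by exact_mod_cast hnN)
    rw [h2]
    linarith
  have h4 := integral_add_compl hB hf
  rw [integral_sub (integrable_const _) hf.restrict] at h1
  simp only [integral_const, smul_eq_mul, measureReal_restrict_apply_univ] at h1
  have h5 : μ.real Bᶜ ≤ μ.real Set.univ := measureReal_mono (Set.subset_univ _)
  nlinarith

/-- If `ρ` has positive integral, then on a nonnull set its Birkhoff sums tend to infinity both in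
the future and in the past. -/
theorem measure_birkhoffSum_tendsto_atTop_two_sided_ne_zero {X : Type*} [TopologicalSpace X]
    [MeasurableSpace X] [BorelSpace X] {μ : Measure X} [IsFiniteMeasure μ] (T : X ≃ₜ X)
    (hT : MeasurePreserving T μ μ) {f : X → ℝ}
    (hfm : Measurable f) (hf : Integrable f μ) (hpos : 0 < ∫ x, f x ∂μ) :
    μ {x | Tendsto (fun n => birkhoffSum T f n x) atTop atTop ∧
      Tendsto (fun n => birkhoffSum T.symm (f ∘ T.symm) n x) atTop atTop} ≠ 0 := by
  have h1 := setIntegral_birkhoffSum_tendsto_atTop_pos hT hfm hf hpos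
  set B := {x | Tendsto (fun n => birkhoffSum T f n x) atTop atTop} with hBdef
  have hB : MeasurableSet B := measurableSet_birkhoffSum_tendsto_atTop hT.measurable hfm
  have hBT : T ⁻¹' B = B := preimage_birkhoffSum_tendsto_atTop T f
  -- `B` is invariant and carries positive integral, so the one-sided result applies again, to the
  -- inverse of `T` on `B`.
  have hTB : MeasurePreserving T (μ.restrict B) (μ.restrict B) := by
    have := hT.restrict_preimage hB
    rwa [hBT] at this
  have hTs : MeasurePreserving T.symm (μ.restrict B) (μ.restrict B) :=
    MeasurePreserving.symm T.toMeasurableEquiv hTB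
  have hfi : Integrable (f ∘ T.symm) (μ.restrict B) :=
    hTs.integrable_comp_of_integrable hf.restrict
  have h2 : 0 < ∫ x, (f ∘ T.symm) x ∂(μ.restrict B) := by
    have h3 : ∫ x, (f ∘ T.symm) x ∂(μ.restrict B) = ∫ x in B, f x ∂μ :=
      hTs.integral_comp' (f := T.symm.toMeasurableEquiv) f
    rwa [h3]
  have h4 := setIntegral_birkhoffSum_tendsto_atTop_pos hTs (hfm.comp hTs.measurable) hfi h2
  intro h0
  rw [Measure.restrict_restrict
    (measurableSet_birkhoffSum_tendsto_atTop hTs.measurable (hfm.comp hTs.measurable)),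
    setIntegral_measure_zero] at h4
  · exact lt_irrefl _ h4
  · rw [Set.inter_comm]
    exact h0

/-! ### Sublinear growth excludes escape -/

/-- Visits of an orbit to the set where Birkhoff sums of order at least `N` exceed one are few,
when the Birkhoff sums stay bounded by `R`. -/
theorem card_visits_le {X : Type*} (T : X → X) (f : X → ℝ) {N : ℕ} (hN : 0 < N) (n : ℕ) (x : X)
    {R : ℝ} (hR0 : 0 ≤ R) (hR : ∀ j < n, |birkhoffSum T f j x| ≤ R) (s : Finset ℕ)
    (hs : ∀ j ∈ s, j < n ∧ ∀ m ≥ N, 1 < |birkhoffSum T f m (T^[j] x)|) :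
    (s.card : ℝ) ≤ N * (2 * R + 2) := by
  -- Pigeonhole on `(j % N, ⌊S_j⌋)`: two visits with the same residue are at least `N` apart, so
  -- their sums differ by more than one and cannot share a floor.
  have hcard : s.card ≤ (Finset.range N ×ˢ Finset.Icc ⌊-R⌋ ⌊R⌋).card := by
    refine Finset.card_le_card_of_injOn (fun j => (j % N, ⌊birkhoffSum T f j x⌋)) ?_ ?_
    · intro j hj
      have h := abs_le.1 (hR j (hs j hj).1)
      simp only [Finset.coe_product, Set.mem_prod, Finset.mem_coe, Finset.mem_range,
        Finset.mem_Icc]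
      exact ⟨Nat.mod_lt _ hN, Int.floor_le_floor h.1, Int.floor_le_floor h.2⟩
    · have key : ∀ i ∈ s, ∀ j ∈ s, i % N = j % N →
          ⌊birkhoffSum T f i x⌋ = ⌊birkhoffSum T f j x⌋ → ¬ i < j := by
        intro i hi j hj hmod hfl hij
        have h1 : N ≤ j - i :=
          Nat.le_of_dvd (Nat.sub_pos_of_lt hij) ((Nat.modEq_iff_dvd' hij.le).1 hmod)
        have h2 := (hs i hi).2 _ h1
        have h3 := birkhoffSum_add T f i (j - i) x
        rw [Nat.add_sub_cancel' hij.le] at h3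
        have h4 := Int.abs_sub_lt_one_of_floor_eq_floor hfl
        rw [abs_sub_comm, h3, add_sub_cancel_left] at h4
        exact lt_asymm h2 h4
      intro i hi j hj hij
      obtain ⟨h1, h2⟩ := Prod.mk.inj hij
      exact le_antisymm (not_lt.1 (key j hj i hi h1.symm h2.symm)) (not_lt.1 (key i hi j hj h1 h2))
  rw [Finset.card_product, Finset.card_range, Int.card_Icc] at hcard
  have h5 : ((⌊R⌋ + 1 - ⌊-R⌋).toNat : ℝ) ≤ 2 * R + 2 := by
    have h6 : (0 : ℤ) ≤ ⌊R⌋ + 1 - ⌊-R⌋ := by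
      have : ⌊-R⌋ ≤ ⌊R⌋ := Int.floor_le_floor (by linarith)
      omega
    have h7 : ((⌊R⌋ + 1 - ⌊-R⌋).toNat : ℝ) = ((⌊R⌋ + 1 - ⌊-R⌋ : ℤ) : ℝ) := by
      exact_mod_cast Int.toNat_of_nonneg h6
    rw [h7]
    push_cast
    linarith [Int.floor_le R, Int.lt_floor_add_one (-R)]
  calc (s.card : ℝ) ≤ (N * (⌊R⌋ + 1 - ⌊-R⌋).toNat : ℕ) := by exact_mod_cast hcard
    _ = N * ((⌊R⌋ + 1 - ⌊-R⌋).toNat : ℝ) := by push_cast; ring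
    _ ≤ N * (2 * R + 2) := by gcongr

/-- Up to time `n` the sums stay within `ε * n + O(1)`, so an orbit visits this set at most about `2
* N * ε * n` times. Integrating, dividing by `n`, and letting `n → ∞` and then `ε → 0` makes its
measure zero. -/
theorem measure_birkhoffSum_gt_one_eq_zero {X : Type*} [MeasurableSpace X] {μ : Measure X}
    [IsFiniteMeasure μ] {T : X → X} (hT : MeasurePreserving T μ μ) {f : X → ℝ}
    (hfm : Measurable f) {C : ℝ} (hC : ∀ x, |f x| ≤ C)
    (h : ∀ ε > 0, ∀ᶠ n : ℕ in atTop, ∀ x, |birkhoffSum T f n x| ≤ ε * n)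
    {N : ℕ} (hN : 0 < N) : μ {x | ∀ m ≥ N, 1 < |birkhoffSum T f m x|} = 0 := by
  classical
  set A := {x | ∀ m ≥ N, 1 < |birkhoffSum T f m x|} with hAdef
  have hA : MeasurableSet A := by
    have : A = ⋂ m ≥ N, {x | 1 < |birkhoffSum T f m x|} := by
      ext x
      simp [hAdef]
    rw [this]
    exact MeasurableSet.iInter fun m => MeasurableSet.iInter fun _ =>
      measurableSet_lt measurable_const (measurable_birkhoffSum hT.measurable hfm m).abs
  rcases isEmpty_or_nonempty X with hX | ⟨⟨x₀⟩⟩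
  · rw [Set.eq_empty_of_isEmpty A, measure_empty]
  have hC0 : 0 ≤ C := (abs_nonneg _).trans (hC x₀)
  set g : X → ℝ := A.indicator fun _ => 1 with hg
  have hgi : Integrable g μ := (integrable_const 1).indicator hA
  have hgint : ∫ x, g x ∂μ = μ.real A := by
    rw [hg, integral_indicator hA]
    simp
  have hbound : ∀ ε > 0, μ.real A ≤ N * (2 * ε) * μ.real Set.univ := by
    intro ε hε
    obtain ⟨n₀, hn₀⟩ := eventually_atTop.1 (h ε hε)
    -- The term `n₀ * C` covers the times before `n₀`, when only the trivial bound on the sums is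
    -- available.
    have hR : ∀ n : ℕ, ∀ x, ∀ j < n, |birkhoffSum T f j x| ≤ ε * n + n₀ * C := by
      intro n x j hj
      rcases le_total n₀ j with hj' | hj'
      · have h1 : ε * j ≤ ε * n := by gcongr
        have h2 : 0 ≤ n₀ * C := by positivity
        linarith [hn₀ j hj' x]
      · have h1 : j * C ≤ n₀ * C := by gcongr
        have h2 : 0 ≤ ε * n := by positivity
        linarith [abs_birkhoffSum_le (T := T) hC j x]
    have hsum : ∀ n : ℕ, ∀ x, birkhoffSum T g n x ≤ N * (2 * (ε * n + n₀ * C) + 2) := by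
      intro n x
      have h1 := card_visits_le T f hN n x (by positivity) (hR n x) {j ∈ Finset.range n | T^[j] x ∈ A}
        fun j hj => by
          rw [Finset.mem_filter, Finset.mem_range] at hj
          exact hj
      refine le_trans (le_of_eq ?_) h1
      rw [Finset.card_filter, birkhoffSum]
      push_cast
      exact Finset.sum_congr rfl fun j _ => by simp [hg, Set.indicator_apply]
    have hint : ∀ n : ℕ, n * μ.real A ≤ N * (2 * (ε * n + n₀ * C) + 2) * μ.real Set.univ := by
      intro n
      rw [← hgint, ← integral_birkhoffSum hT hgi]
      calc ∫ x, birkhoffSum T g n x ∂μ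
          ≤ ∫ _, (N * (2 * (ε * n + n₀ * C) + 2) : ℝ) ∂μ := by
            refine integral_mono_of_nonneg (ae_of_all _ fun x => ?_) (integrable_const _)
              (ae_of_all _ (hsum n))
            exact Finset.sum_nonneg fun j _ => Set.indicator_nonneg (fun _ _ => zero_le_one) _
        _ = _ := by rw [integral_const, smul_eq_mul, mul_comm]
    have hlim : Tendsto (fun n : ℕ => N * (2 * ε) * μ.real Set.univ +
        (N * (2 * (n₀ * C) + 2) * μ.real Set.univ) / n) atTop
        (𝓝 (N * (2 * ε) * μ.real Set.univ + 0)) :=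
      tendsto_const_nhds.add (tendsto_const_div_atTop_nhds_zero_nat _)
    rw [add_zero] at hlim
    refine ge_of_tendsto hlim ?_
    filter_upwards [eventually_gt_atTop 0] with n hn
    have hn' : (0 : ℝ) < n := by exact_mod_cast hn
    rw [← mul_le_mul_iff_right₀ hn']
    refine (hint n).trans (le_of_eq ?_)
    field_simp
    ring
  have hlim : Tendsto (fun ε : ℝ => N * (2 * ε) * μ.real Set.univ) (𝓝[>] 0) (𝓝 0) := by
    have : Continuous fun ε : ℝ => N * (2 * ε) * μ.real Set.univ := by fun_prop
    have h1 := (this.tendsto 0).mono_left (nhdsWithin_le_nhds (s := Set.Ioi 0))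
    simpa using h1
  have h0 : μ.real A ≤ 0 := ge_of_tendsto hlim (by
    filter_upwards [self_mem_nhdsWithin] with ε hε
    exact hbound ε hε)
  exact (measureReal_eq_zero_iff).1 (le_antisymm h0 measureReal_nonneg)

/-- If Birkhoff sums grow sublinearly, uniformly, then almost surely they do not escape to
infinity. -/
theorem measure_abs_birkhoffSum_tendsto_atTop_eq_zero {X : Type*} [MeasurableSpace X]
    {μ : Measure X} [IsFiniteMeasure μ] {T : X → X} (hT : MeasurePreserving T μ μ) {f : X → ℝ}
    (hfm : Measurable f) {C : ℝ} (hC : ∀ x, |f x| ≤ C)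
    (h : ∀ ε > 0, ∀ᶠ n : ℕ in atTop, ∀ x, |birkhoffSum T f n x| ≤ ε * n) :
    μ {x | Tendsto (fun n => |birkhoffSum T f n x|) atTop atTop} = 0 := by
  refine measure_mono_null (t := ⋃ N : ℕ, {x | ∀ m ≥ N + 1, 1 < |birkhoffSum T f m x|}) ?_
    (measure_iUnion_null fun N => measure_birkhoffSum_gt_one_eq_zero hT hfm hC h N.succ_pos)
  intro x hx
  obtain ⟨N, hN⟩ := eventually_atTop.1 ((tendsto_atTop.1 hx) 2)
  exact Set.mem_iUnion.2 ⟨N, fun m hm => one_lt_two.trans_le (hN m (by omega))⟩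

/-! ### Proper orbits of the cascade -/

theorem orbitMap_natCast {Y : Type*} [TopologicalSpace Y] (F : Y ≃ₜ Y) (p : Y) (n : ℕ) :
    orbitMap F p n = F^[n] p := by
  simp only [orbitMap, zpow_natCast]
  induction n generalizing p with
  | zero => rfl
  | succ n ih => rw [pow_succ, Function.iterate_succ_apply, ← ih]; rfl

theorem orbitMap_neg_natCast {Y : Type*} [TopologicalSpace Y] (F : Y ≃ₜ Y) (p : Y) (n : ℕ) :
    orbitMap F p (-n) = F.symm^[n] p := by
  rw [← orbitMap_natCast F.symm, orbitMap, orbitMap, zpow_neg, ← inv_zpow]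
  rfl

theorem orbitMap_orbitMap {Y : Type*} [TopologicalSpace Y] (F : Y ≃ₜ Y) (p : Y) (m n : ℤ) :
    orbitMap F (orbitMap F p m) n = orbitMap F p (n + m) := by
  simp only [orbitMap, zpow_add]
  rfl

theorem cylindricalCascade_iterate {X : Type*} [TopologicalSpace X] (T : X ≃ₜ X) (ρ : C(X, ℝ))
    (n : ℕ) (p : X × ℝ) :
    (cylindricalCascade T ρ)^[n] p = (T^[n] p.1, p.2 + birkhoffSum T ρ n p.1) := by
  induction n with
  | zero => simp
  | succ n ih =>
    rw [Function.iterate_succ_apply', ih, birkhoffSum_succ, Function.iterate_succ_apply',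
      ← add_assoc]
    rfl

theorem cylindricalCascade_symm_iterate {X : Type*} [TopologicalSpace X] (T : X ≃ₜ X)
    (ρ : C(X, ℝ)) (n : ℕ) (p : X × ℝ) :
    (cylindricalCascade T ρ).symm^[n] p =
      (T.symm^[n] p.1, p.2 - birkhoffSum T.symm (ρ ∘ T.symm) n p.1) := by
  induction n with
  | zero => simp
  | succ n ih =>
    rw [Function.iterate_succ_apply', ih, birkhoffSum_succ, Function.iterate_succ_apply',
      ← sub_sub]
    rfl

theorem tendsto_abs_const_add_atTop {u : ℕ → ℝ} (v : ℝ)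
    (h : Tendsto (fun n => |u n|) atTop atTop) : Tendsto (fun n => |v + u n|) atTop atTop := by
  refine tendsto_atTop_mono (fun n => ?_) (tendsto_atTop_add_const_left _ (-|v|) h)
  have := abs_sub (v + u n) v
  rw [add_sub_cancel_left] at this
  linarith

/-- A proper orbit escapes to infinity in the vertical direction. -/
theorem tendsto_abs_birkhoffSum_of_isProperMap {X : Type*} [MetricSpace X] [CompactSpace X]
    (T : X ≃ₜ X) (ρ : C(X, ℝ)) (p : X × ℝ)
    (hp : IsProperMap (orbitMap (cylindricalCascade T ρ) p)) :
    Tendsto (fun n => |birkhoffSum T ρ n p.1|) atTop atTop := by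
  have h1 : IsProperMap (Prod.snd ∘ orbitMap (cylindricalCascade T ρ) p) :=
    isProperMap_snd_of_compactSpace.comp hp
  have h2 := (isProperMap_iff_tendsto_cocompact.1 h1).2
  rw [cocompact_eq_cofinite, Int.cofinite_eq] at h2
  have h3 : Tendsto (fun n : ℕ => (n : ℤ)) atTop (atBot ⊔ atTop) :=
    tendsto_natCast_atTop_atTop.mono_right le_sup_right
  have h4 := (tendsto_norm_cocompact_atTop (E := ℝ)).comp (h2.comp h3)
  have h5 : Tendsto (fun n => |p.2 + birkhoffSum T ρ n p.1|) atTop atTop := by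
    refine h4.congr fun n => ?_
    simp only [Function.comp_apply, orbitMap_natCast, cylindricalCascade_iterate,
      Real.norm_eq_abs]
  simpa using tendsto_abs_const_add_atTop (-p.2) h5

/-- An orbit that escapes to infinity vertically in the future and in the past is proper. -/
theorem isProperMap_orbitMap_of_tendsto {X : Type*} [MetricSpace X] [CompactSpace X]
    (T : X ≃ₜ X) (ρ : C(X, ℝ)) (p : X × ℝ)
    (h1 : Tendsto (fun n => |birkhoffSum T ρ n p.1|) atTop atTop)
    (h2 : Tendsto (fun n => |birkhoffSum T.symm (ρ ∘ T.symm) n p.1|) atTop atTop) :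
    IsProperMap (orbitMap (cylindricalCascade T ρ) p) := by
  rw [isProperMap_iff_tendsto_cocompact]
  refine ⟨continuous_of_discreteTopology, ?_⟩
  -- The compact factor contributes `⊥` to the coproduct filter, so only escape of the real
  -- coordinate has to be checked.
  rw [cocompact_eq_cofinite, ← coprod_cocompact, cocompact_eq_bot, bot_coprod,
    tendsto_comap_iff, ← Metric.cobounded_eq_cocompact, ← tendsto_norm_atTop_iff_cobounded,
    Int.cofinite_eq, tendsto_sup]
  constructor
  · rw [← map_neg_atTop, ← Nat.map_cast_int_atTop, tendsto_map'_iff, tendsto_map'_iff]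
    have h3 := tendsto_abs_const_add_atTop (-p.2) h2
    refine h3.congr fun n => ?_
    simp only [Function.comp_apply, orbitMap_neg_natCast, cylindricalCascade_symm_iterate,
      Real.norm_eq_abs]
    rw [← abs_neg]
    congr 1
    ring
  · rw [← Nat.map_cast_int_atTop, tendsto_map'_iff]
    refine (tendsto_abs_const_add_atTop p.2 h1).congr fun n => ?_
    simp only [Function.comp_apply, orbitMap_natCast, cylindricalCascade_iterate,
      Real.norm_eq_abs]

theorem tendsto_abs_birkhoffSum_of_mem_properOrbitUnion {X : Type*} [MetricSpace X]
    [CompactSpace X] (T : X ≃ₜ X) (ρ : C(X, ℝ)) {x : X}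
    (hx : x ∈ Prod.fst '' properOrbitUnion (cylindricalCascade T ρ)) :
    Tendsto (fun n => |birkhoffSum T ρ n x|) atTop atTop := by
  obtain ⟨q, hq, rfl⟩ := hx
  simp only [properOrbitUnion, Set.mem_iUnion] at hq
  obtain ⟨p, hp, m, rfl⟩ := hq
  refine tendsto_abs_birkhoffSum_of_isProperMap T ρ _ ?_
  have hp' : IsProperMap (orbitMap (cylindricalCascade T ρ) p) := hp
  have h := hp'.comp (Homeomorph.addRight m).isProperMap
  convert h using 1
  -- Moving the base point along the orbit by `m` is a translation of `ℤ`, which preserves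
  -- properness.
  ext1 n
  exact orbitMap_orbitMap _ p m n

theorem mem_image_fst_properOrbitUnion {X : Type*} [MetricSpace X] [CompactSpace X]
    (T : X ≃ₜ X) (ρ : C(X, ℝ)) {x : X}
    (h1 : Tendsto (fun n => |birkhoffSum T ρ n x|) atTop atTop)
    (h2 : Tendsto (fun n => |birkhoffSum T.symm (ρ ∘ T.symm) n x|) atTop atTop) :
    x ∈ Prod.fst '' properOrbitUnion (cylindricalCascade T ρ) := by
  refine ⟨(x, 0), ?_, rfl⟩
  simp only [properOrbitUnion, Set.mem_iUnion]
  exact ⟨(x, 0), isProperMap_orbitMap_of_tendsto T ρ (x, 0) h1 h2, 0, rfl⟩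

/-- A nonzero mean makes `ρ` or `-ρ` escape in both time directions on a nonnull set, whose points
all lie under proper orbits. -/
theorem integral_eq_zero_of_properOrbitUnion_null {X : Type*} [MetricSpace X] [CompactSpace X]
    [MeasurableSpace X] [BorelSpace X] (T : X ≃ₜ X) (ρ : C(X, ℝ)) {μ : Measure X}
    [IsFiniteMeasure μ] (hT : MeasurePreserving T μ μ)
    (h : μ (Prod.fst '' properOrbitUnion (cylindricalCascade T ρ)) = 0) : ∫ x, ρ x ∂μ = 0 := by
  by_contra hne
  rcases lt_or_gt_of_ne hne with hneg | hpos
  · refine measure_birkhoffSum_tendsto_atTop_two_sided_ne_zero T hT (f := -ρ)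
      ρ.continuous.measurable.neg (integrable_continuousMap μ ρ).neg ?_
      (measure_mono_null (fun x hx => ?_) h)
    · simp only [Pi.neg_apply, integral_neg]
      linarith
    · refine mem_image_fst_properOrbitUnion T ρ ?_ ?_
      · refine (tendsto_abs_atTop_atTop.comp hx.1).congr fun n => ?_
        simp [birkhoffSum_neg]
      · refine (tendsto_abs_atTop_atTop.comp hx.2).congr fun n => ?_
        simp [birkhoffSum]
  · refine measure_birkhoffSum_tendsto_atTop_two_sided_ne_zero T hT
      ρ.continuous.measurable (integrable_continuousMap μ ρ) hpos
      (measure_mono_null (fun x hx => ?_) h)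
    exact mem_image_fst_properOrbitUnion T ρ (tendsto_abs_atTop_atTop.comp hx.1)
      (tendsto_abs_atTop_atTop.comp hx.2)

/-! ### The equivalences -/

theorem mainTheorem5 {X : Type*} [MetricSpace X] [CompactSpace X]
    [MeasurableSpace X] [BorelSpace X]
    (T : X ≃ₜ X) (hT : IsMinimalHomeo T) (ρ : C(X, ℝ)) :
    List.TFAE [
      -- `ρ` is a uniform limit of continuous coboundaries
      ∃ φ : ℕ → C(X, ℝ),
        Tendsto (fun k => ⨆ x : X, |ρ x - (φ k (T x) - φ k x)|) atTop (𝓝 0),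
      -- the Birkhoff averages of `ρ` converge uniformly to zero
      Tendsto (fun n : ℕ => ⨆ x : X, |birkhoffSum T ρ n x / (n : ℝ)|) atTop (𝓝 0),
      -- the base points of the proper orbits of the cascade form a null set
      -- for every invariant probability measure
      ∀ μ : Measure X, IsProbabilityMeasure μ → MeasurePreserving T μ μ →
        μ (Prod.fst '' properOrbitUnion (cylindricalCascade T ρ)) = 0,
      -- `ρ` has zero mean for every invariant probability measure
      ∀ μ : Measure X, IsProbabilityMeasure μ → MeasurePreserving T μ μ →
        ∫ x, ρ x ∂μ = 0,
      -- `ρ` has zero mean for every ergodic invariant probability measure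
      ∀ μ : Measure X, IsProbabilityMeasure μ → Ergodic T μ →
        ∫ x, ρ x ∂μ = 0] := by
  
  have hTc : Continuous T := T.continuous
  have hbound : ∀ x, |ρ x| ≤ ‖ρ‖ := ρ.norm_coe_le_norm
  tfae_have 1 → 2 := by
    rintro ⟨φ, hφ⟩
    rw [tendsto_iSup_abs_zero_iff _ fun k => by fun_prop] at hφ
    rw [tendsto_iSup_abs_birkhoffSum_div_iff hTc ρ.continuous]
    refine birkhoffSum_small_of_approx_coboundary fun ε hε => ?_
    obtain ⟨k, hk⟩ := (hφ ε hε).exists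
    exact ⟨φ k, hk⟩
  tfae_have 2 → 1 := fun h => exists_approx_coboundary hTc ρ.continuous h
  tfae_have 2 → 3 := by
    intro h μ _ hμ
    refine measure_mono_null
      (fun x hx => tendsto_abs_birkhoffSum_of_mem_properOrbitUnion T ρ hx)
      (measure_abs_birkhoffSum_tendsto_atTop_eq_zero hμ ρ.continuous.measurable hbound ?_)
    exact (tendsto_iSup_abs_birkhoffSum_div_iff hTc ρ.continuous).1 h
  tfae_have 3 → 4 := fun h μ hμ hμT =>
    integral_eq_zero_of_properOrbitUnion_null T ρ hμT (h μ hμ hμT)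
  tfae_have 4 → 5 := fun h μ hμ hμT => h μ hμ hμT.toMeasurePreserving
  tfae_have 5 → 4 := fun h μ _ hμT => integral_eq_zero_of_ergodic hTc ρ h hμT
  tfae_have 4 → 2 := fun h => (tendsto_iSup_abs_birkhoffSum_div_iff hTc ρ.continuous).2
    (birkhoffSum_small_of_integral_eq_zero hTc ρ h)
  tfae_finish
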